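/- Let $k\ge 1$, $r\ge 2$ and $n\ge 0$ be integers such that $k+1$ and $r-1$ are relatively prime, and let $t,q\in\mathbb C$ be primitive roots of unity of orders $k+1$ and $r-1$, respectively. For a set $S\subset\mathbb C\setminus\{0\}$, a symmetric polynomial $f\in\mathbb C[x_1,\dots,x_n]^{\mathfrak S_n}$ satisfies the wheel condition relative to $S$ if it vanishes on all planes $x_2=t_1x_1,\ x_3=t_2x_2,\ \dots,\ x_l=t_{l-1}x_{l-1},\ x_1=t_lx_l$ with $1\le l\le n$, $t_1,\dots,t_l\in S$ and $\prod_{i=1}^l t_i=1$. Let $F_n^{(k,r)}$ be the space of symmetric polynomials satisfying the wheel condition relative to $\{t,tq,\dots,tq^{r-2}\}$, and $F_n^{(k,2)}$ the space of those satisfying it relative to $\{t\}$. Let $\mathcal F:\mathbb C[x_1,\dots,x_n]\to\mathbb C[x_1,\dots,x_n]$, $f(x_1,\dots,x_n)\mapsto f(x_1^{r-1},\dots,x_n^{r-1})$, be the Frobenius homomorphism, and $R_n=\mathcal F(F_n^{(k,2)})\cap F_n^{(k,r)}$. A partition $\lambda=(\lambda_1\ge\dots\ge\lambda_n\ge 0)$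 is $(r-1)$-slim if $\lambda_i-\lambda_{i+1}<r-1$ for $1\le i\le n-1$ and $\lambda_n<r-1$. A polynomial $g$ is of highest partition $\lambda$ if $g=c_\lambda m_\lambda+\sum_{\mu<\lambda}c_\mu m_\mu$ with $c_\mu\in\mathbb C$, $c_\lambda\ne 0$, where the $m_\mu$ are the monomial symmetric polynomials and $<$ is the dominance order on partitions of equal weight. Let $h=\sum_{i=1}^s f_ig_i$ be a symmetric polynomial in $x_1,\dots,x_n$, where $g_1,\dots,g_s$ have highest partitions which are $(r-1)$-slim and pairwise distinct, and $f_i=\mathcal F(\tilde f_i)$ with $\tilde f_i\in\mathbb C[x_1,\dots,x_n]$. Then $h\in F_n^{(k,r)}$ if and only if $f_i\in R_n$ for all $i$. Moreover, for each $i$, $f_i\in R_n$ if and only if $\tilde f_i\in F_n^{(k,2)}$. -/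

import Mathlib

namespace Wheel

open MvPolynomial

/-- `π_n`: the partitions of length at most `n`, as nonincreasing sequences of `n` naturals. -/
abbrev Part (n : ℕ) : Type := {a : Fin n → ℕ // Antitone a}

/-- The strict dominance order `μ < lam` on partitions of the same weight. -/
def DomLT {n : ℕ} (μ lam : Part n) : Prop :=
  μ ≠ lam ∧ ∑ j, μ.1 j = ∑ j, lam.1 j ∧
    ∀ i : Fin n, ∑ j ∈ Finset.Iic i, μ.1 j ≤ ∑ j ∈ Finset.Iic i, lam.1 j

/-- `lam` is `d`-slim: `lam_i - lam_{i+1} < d` for `1 ≤ i ≤ n - 1`, and `lam_n < d`. -/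
def IsSlim {n : ℕ} (d : ℕ) (lam : Part n) : Prop :=
  (∀ i j : Fin n, (j : ℕ) = (i : ℕ) + 1 → lam.1 i < lam.1 j + d) ∧
    ∀ i : Fin n, (i : ℕ) + 1 = n → lam.1 i < d

/-- The monomial symmetric polynomial `m_lam`: the sum of the distinct monomials obtained from
`x_1 ^ lam_1 ⋯ x_n ^ lam_n` by permuting the variables. -/
noncomputable def monomialSymm {n : ℕ} (lam : Part n) : MvPolynomial (Fin n) ℂ :=
  ∑ a ∈ Finset.univ.image (fun w : Equiv.Perm (Fin n) => lam.1 ∘ w),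
    monomial (Finsupp.equivFunOnFinite.symm a) 1

/-- `g` is of highest partition `lam`: `g = c_lam m_lam + ∑_{μ < lam} c_μ m_μ` with
`c_lam ≠ 0`. -/
def HasHighestPartition {n : ℕ} (g : MvPolynomial (Fin n) ℂ) (lam : Part n) : Prop :=
  ∃ c : Part n →₀ ℂ, c lam ≠ 0 ∧ (∀ μ, c μ ≠ 0 → μ = lam ∨ DomLT μ lam) ∧
    g = c.sum fun μ a => a • monomialSymm μ

/-- The point `x` lies on the plane `x_2 = τ_1 x_1, …, x_l = τ_{l-1} x_{l-1}, x_1 = τ_l x_l`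
(`finRotate l` is the cyclic shift `i ↦ i + 1` of the `l` indices). -/
def OnWheelPlane {n l : ℕ} (hl : l ≤ n) (τ : Fin l → ℂ) (x : Fin n → ℂ) : Prop :=
  ∀ i : Fin l, x (Fin.castLE hl (finRotate l i)) = τ i * x (Fin.castLE hl i)

/-- The space of symmetric polynomials in `n` variables that satisfy the wheel condition relative
to `S`: they vanish on all the planes `x_2 = τ_1 x_1, …, x_1 = τ_l x_l` with `τ_i ∈ S` that
satisfy the resonance condition `∏ τ_i = 1`. -/
noncomputable def wheelSpace (n : ℕ) (S : Set ℂ) : Submodule ℂ (MvPolynomial (Fin n) ℂ) where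
  carrier := {f | f.IsSymmetric ∧ ∀ (l : ℕ) (_ : 0 < l) (hl : l ≤ n) (τ : Fin l → ℂ),
    (∀ i, τ i ∈ S) → ∏ i, τ i = 1 → ∀ x : Fin n → ℂ, OnWheelPlane hl τ x → eval x f = 0}
  add_mem' := by
    rintro f g ⟨hf, hf'⟩ ⟨hg, hg'⟩
    refine ⟨hf.add hg, fun l h0 hl τ hτ hp x hx => ?_⟩
    rw [map_add, hf' l h0 hl τ hτ hp x hx, hg' l h0 hl τ hτ hp x hx, add_zero]
  zero_mem' := ⟨IsSymmetric.zero, fun _ _ _ _ _ _ _ _ => map_zero _⟩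
  smul_mem' := by
    rintro c f ⟨hf, hf'⟩
    refine ⟨hf.smul c, fun l h0 hl τ hτ hp x hx => ?_⟩
    rw [smul_eval, hf' l h0 hl τ hτ hp x hx, mul_zero]

/-- The wheel set `{t, t q, …, t q ^ (m - 1)}`. -/
def wheelSet (m : ℕ) (q t : ℂ) : Set ℂ := {z | ∃ j < m, z = t * q ^ j}

/-- `F_n^{(k,r)}`, with `t` and `q` primitive roots of unity of orders `k + 1` and `r - 1`:
the wheel set is `{t, t q, …, t q ^ (r - 2)}`. -/
noncomputable def F (n r : ℕ) (q t : ℂ) : Submodule ℂ (MvPolynomial (Fin n) ℂ) :=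
  wheelSpace n (wheelSet (r - 1) q t)

/-- The Frobenius homomorphism `f(x_1, …, x_n) ↦ f(x_1 ^ (r - 1), …, x_n ^ (r - 1))`. -/
noncomputable def frob (n r : ℕ) : MvPolynomial (Fin n) ℂ →ₐ[ℂ] MvPolynomial (Fin n) ℂ :=
  expand (r - 1)

/-- `R_n`: the intersection with `F_n^{(k,r)}` of the Frobenius image of `F_n^{(k,2)}`
(where `r = 2`, so that `q = 1`). -/
noncomputable def R (n r : ℕ) (q t : ℂ) : Submodule ℂ (MvPolynomial (Fin n) ℂ) :=
  (F n 2 1 t).map (frob n r).toLinearMap ⊓ F n r q t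

end Wheel

/-! Put `d = r - 1`. Over a point `y` with distinct nonzero coordinates, the Frobenius map has `d ^
n` preimages, no two related by a permutation, so symmetric polynomials take arbitrary values on
this fibre (`exists_isSymmetric_eval_eq_ite`). There are also `d ^ n` slim partitions. Subtracting
lexicographic leading terms writes every symmetric polynomial through polynomials with slim highest
partitions, with Frobenius coefficients, which are constant on the fibre
(`eval_mem_span_of_isSymmetric`). Hence the slim family restricts to a basis of the functions on the
fibre, and `∑ f̃_i(y) g_i(x) = 0` for all `x` over `y` forces every `f̃_i(y) = 0`
(`eq_zero_of_sum_eval_eq_zero`).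

By `mem_F_iff`, membership in `F_n^{(k,r)}` depends only on the fibres: it is vanishing at all `x`
whose coordinatewise `d`-th power lies on a `t ^ d`-wheel. By coprimality this is a reordered
`t`-wheel. Generic wheel points have distinct nonzero coordinates, so the independence applies
there, and density covers the rest. -/

namespace Wheel
open MvPolynomial MonomialOrder

variable {n : ℕ}

/-! ### Lexicographic leading exponents of symmetric polynomials. -/

/-- Sequences with dominated partial sums are lexicographically smaller. -/
theorem lex_le_of_sum_Iic_le {a b : Fin n →₀ ℕ}
    (hab : ∀ i, ∑ j ∈ Finset.Iic i, a j ≤ ∑ j ∈ Finset.Iic i, b j) : a ≼[lex] b := by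
  rw [lex_le_iff]
  by_contra! hlt
  obtain ⟨i, hi, hlt⟩ := hlt
  have hi' : ∀ j ∈ Finset.Iio i, b j = a j := fun j hj => hi j (Finset.mem_Iio.1 hj)
  have hlt' : b i < a i := hlt
  have hsum : ∑ j ∈ Finset.Iio i, b j = ∑ j ∈ Finset.Iio i, a j := Finset.sum_congr rfl hi'
  have := hab i
  rw [← Finset.Iio_insert, Finset.sum_insert (by simp), Finset.sum_insert (by simp)] at this
  omega

/-- This is the rearrangement inequality against the indicator of an initial segment. -/
theorem sum_Iic_comp_perm_le {a : Fin n → ℕ} (ha : Antitone a) (w : Equiv.Perm (Fin n))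
    (i : Fin n) : ∑ j ∈ Finset.Iic i, a (w j) ≤ ∑ j ∈ Finset.Iic i, a j := by
  have hmono : Monovary (fun j => if j ≤ i then 1 else 0 : Fin n → ℕ) a :=
    Antitone.monovary (fun x y hxy => by
      split_ifs <;> omega) ha
  have := hmono.sum_mul_comp_perm_le_sum_mul (σ := w)
  simpa [← Finset.sum_filter, Finset.filter_ge_eq_Iic] using this

/-- The exponent vector of a sequence of naturals. -/
noncomputable abbrev expo (a : Fin n → ℕ) : Fin n →₀ ℕ := Finsupp.equivFunOnFinite.symm a

theorem expo_comp_perm_le {a : Fin n → ℕ} (ha : Antitone a) (w : Equiv.Perm (Fin n)) :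
    expo (a ∘ w) ≼[lex] expo a :=
  lex_le_of_sum_Iic_le fun i => by simpa using sum_Iic_comp_perm_le ha w i

theorem coeff_monomialSymm (μ : Part n) (b : Fin n →₀ ℕ)
    [Decidable (∃ w : Equiv.Perm (Fin n), μ.1 ∘ w = b)] :
    coeff b (monomialSymm μ) = if ∃ w : Equiv.Perm (Fin n), μ.1 ∘ w = b then 1 else 0 := by
  classical
  simp only [monomialSymm, coeff_sum, coeff_monomial, Equiv.symm_apply_eq]
  rw [Finset.sum_ite_eq']
  simp [Finsupp.equivFunOnFinite]

theorem isSymmetric_monomialSymm (μ : Part n) : (monomialSymm μ).IsSymmetric := by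
  classical
  intro e
  ext b
  obtain ⟨b, rfl⟩ : ∃ b', Finsupp.mapDomain e b' = b :=
    ⟨Finsupp.mapDomain e.symm b, by simp [← Finsupp.mapDomain_comp]⟩
  rw [coeff_rename_mapDomain _ e.injective, coeff_monomialSymm, coeff_monomialSymm]
  have hb : (⇑(Finsupp.mapDomain e b) : Fin n → ℕ) = b ∘ e.symm := by
    ext j
    simp [← Finsupp.equivMapDomain_eq_mapDomain]
  rw [hb]
  refine if_congr ⟨fun ⟨w, hw⟩ => ⟨e.symm.trans w, ?_⟩, fun ⟨w, hw⟩ => ⟨e.trans w, ?_⟩⟩ rfl rfl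
  · rw [← hw]; ext; simp
  · ext j; simpa using congrFun hw (e j)

theorem HasHighestPartition.isSymmetric {g : MvPolynomial (Fin n) ℂ} {lam : Part n}
    (hg : HasHighestPartition g lam) : g.IsSymmetric := by
  obtain ⟨c, -, -, rfl⟩ := hg
  exact (symmetricSubalgebra (Fin n) ℂ).sum_mem fun μ _ =>
    (symmetricSubalgebra (Fin n) ℂ).smul_mem (isSymmetric_monomialSymm μ) _

theorem HasHighestPartition.monomialSymm (lam : Part n) :
    HasHighestPartition (monomialSymm lam) lam := by
  classical
  refine ⟨Finsupp.single lam 1, by simp, fun μ hμ => Or.inl ?_, by simp⟩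
  by_contra hne
  exact hμ (by simp [Ne.symm hne])

/-- Each of the two sequences is the lexicographic maximum of their common orbit. -/
theorem eq_of_comp_perm {a b : Fin n → ℕ} (ha : Antitone a) (hb : Antitone b)
    {w : Equiv.Perm (Fin n)} (h : a ∘ w = b) : a = b := by
  have h1 := expo_comp_perm_le ha w
  have h2 := expo_comp_perm_le hb w⁻¹
  rw [← h] at h2
  have h3 : (a ∘ w) ∘ ⇑w⁻¹ = a := by ext; simp
  rw [h3] at h2
  have := lex.toSyn.injective (le_antisymm h2 h1)
  rw [h] at this
  exact Finsupp.equivFunOnFinite.symm.injective this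

theorem HasHighestPartition.coeff_ne_zero {g : MvPolynomial (Fin n) ℂ} {lam : Part n}
    (hg : HasHighestPartition g lam) : coeff (expo lam.1) g ≠ 0 := by
  classical
  obtain ⟨c, hc, hlt, rfl⟩ := hg
  have : coeff (expo lam.1) (c.sum fun μ a => a • Wheel.monomialSymm μ) = c lam := by
    rw [Finsupp.sum, coeff_sum, Finset.sum_eq_single lam]
    · rw [coeff_smul, coeff_monomialSymm, if_pos ⟨1, by ext; simp⟩, smul_eq_mul, mul_one]
    · intro μ _ hμ
      rw [coeff_smul, coeff_monomialSymm, if_neg, smul_zero]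
      rintro ⟨w, hw⟩
      exact hμ (Subtype.ext (eq_of_comp_perm μ.2 lam.2 hw))
    · intro h
      simp [Finsupp.notMem_support_iff.1 h]
  rwa [this]

theorem degree_eq_of_forall_le {p : MvPolynomial (Fin n) ℂ} {a : Fin n →₀ ℕ}
    (ha : coeff a p ≠ 0) (hle : ∀ b, coeff b p ≠ 0 → b ≼[lex] a) : lex.degree p = a := by
  refine lex.toSyn.injective (le_antisymm ?_ (lex.le_degree (mem_support_iff.2 ha)))
  exact lex.degree_le_iff.2 fun b hb => hle b (mem_support_iff.1 hb)

/-- The highest partition is the degree in the lexicographic monomial order. -/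
theorem HasHighestPartition.degree_eq {g : MvPolynomial (Fin n) ℂ} {lam : Part n}
    (hg : HasHighestPartition g lam) : lex.degree g = expo lam.1 := by
  classical
  refine degree_eq_of_forall_le hg.coeff_ne_zero fun b hb => ?_
  obtain ⟨c, hc, hlt, rfl⟩ := hg
  rw [Finsupp.sum, coeff_sum] at hb
  obtain ⟨μ, hμ, hb⟩ := Finset.exists_ne_zero_of_sum_ne_zero hb
  rw [coeff_smul, coeff_monomialSymm] at hb
  obtain ⟨w, hw⟩ : ∃ w : Equiv.Perm (Fin n), μ.1 ∘ w = b := by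
    by_contra h
    simp [h] at hb
  have hle : ∀ i, ∑ j ∈ Finset.Iic i, μ.1 j ≤ ∑ j ∈ Finset.Iic i, lam.1 j := by
    rcases hlt μ (Finsupp.mem_support_iff.1 hμ) with rfl | h
    · exact fun _ => le_rfl
    · exact h.2.2
  refine lex_le_of_sum_Iic_le fun i => ?_
  rw [← hw]
  exact (sum_Iic_comp_perm_le μ.2 w i).trans (hle i)

theorem degree_expand {d : ℕ} (hd : d ≠ 0) {p : MvPolynomial (Fin n) ℂ} (hp : p ≠ 0) :
    lex.degree (expand d p) = d • lex.degree p := by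
  classical
  refine degree_eq_of_forall_le ?_ fun b hb => ?_
  · rw [coeff_expand_smul _ hd]
    exact lex.coeff_degree_ne_zero_iff.2 hp
  · have := support_expand_subset (p := d) p (mem_support_iff.2 hb)
    obtain ⟨a, ha, rfl⟩ := Finset.mem_image.1 this
    rw [map_nsmul, map_nsmul]
    exact nsmul_le_nsmul_right (lex.le_degree ha) d

/-- The lexicographic degree of a symmetric polynomial is a partition. -/
theorem antitone_degree {p : MvPolynomial (Fin n) ℂ} (hp : p.IsSymmetric) :
    Antitone (lex.degree p) := by
  rcases eq_or_ne p 0 with rfl | h0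
  · simp [antitone_const, Pi.zero_def, degree_zero]
  set a := lex.degree p with ha
  let w : Equiv.Perm (Fin n) := Tuple.sort (fun i => OrderDual.toDual (a i))
  have hw : Antitone (a ∘ w) := Tuple.monotone_sort (fun i => OrderDual.toDual (a i))
  -- By symmetry the sorted exponent also occurs in `p`; it is lexicographically at least `a`, hence
  -- equal to it.
  have hcoeff : coeff (expo (a ∘ w)) p ≠ 0 := by
    have : expo (a ∘ w) = Finsupp.mapDomain w.symm a := by
      ext j
      simp [← Finsupp.equivMapDomain_eq_mapDomain]
    rw [this, ← hp w.symm, coeff_rename_mapDomain _ w.symm.injective]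
    exact lex.coeff_degree_ne_zero_iff.2 h0
  have h1 := lex.le_degree (mem_support_iff.2 hcoeff)
  have h2 := expo_comp_perm_le hw w⁻¹
  have h3 : (a ∘ w) ∘ ⇑w⁻¹ = a := by ext; simp
  have h4 : expo (⇑a : Fin n → ℕ) = a := by ext; simp
  rw [h3, h4] at h2
  have := lex.toSyn.injective (le_antisymm h2 h1)
  have h5 : (a : Fin n → ℕ) = a ∘ w := by
    conv_lhs => rw [this]
    rfl
  rw [h5]
  exact hw

/-! ### Slim partitions and division by `d`. -/

/-- The sequence with given successive differences. -/
def tailSum (e : Fin n → ℕ) : Fin n → ℕ := fun i => ∑ j ∈ Finset.Ici i, e j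

theorem tailSum_antitone (e : Fin n → ℕ) : Antitone (tailSum e) := fun _ _ h =>
  Finset.sum_le_sum_of_subset (Finset.Ici_subset_Ici.2 h)

theorem exists_eq_tailSum {a : Fin n → ℕ} (ha : Antitone a) :
    ∃ e : Fin n → ℕ, tailSum e = a ∧
      (∀ i j : Fin n, (j : ℕ) = (i : ℕ) + 1 → a i = a j + e i) ∧
        ∀ i : Fin n, (i : ℕ) + 1 = n → a i = e i := by
  let e : Fin n → ℕ := fun i => a i - if h : (i : ℕ) + 1 < n then a ⟨i + 1, h⟩ else 0
  have h1 : ∀ i j : Fin n, (j : ℕ) = (i : ℕ) + 1 → a i = a j + e i := by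
    intro i j hij
    have hj : (i : ℕ) + 1 < n := hij ▸ j.2
    have hj' : (⟨i + 1, hj⟩ : Fin n) = j := Fin.ext hij.symm
    have : a j ≤ a i := ha (Fin.le_def.2 (by omega))
    simp only [e, dif_pos hj, hj']
    omega
  have h2 : ∀ i : Fin n, (i : ℕ) + 1 = n → a i = e i := by
    intro i hi
    simp [e, hi]
  refine ⟨e, ?_, h1, h2⟩
  -- Downward induction on `i`, through `m = n - i`.
  have key : ∀ m (i : Fin n), n - (i : ℕ) = m → tailSum e i = a i := by
    intro m
    induction m with
    | zero => intro i hi; omega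
    | succ m ih =>
      intro i hi
      rw [tailSum, ← Finset.Ioi_insert, Finset.sum_insert (by simp)]
      by_cases hlt : (i : ℕ) + 1 < n
      · have hI : Finset.Ioi i = Finset.Ici ⟨i + 1, hlt⟩ := by
          ext j; simp only [Finset.mem_Ioi, Finset.mem_Ici, Fin.lt_def, Fin.le_def, Nat.succ_le_iff]
        have := ih ⟨i + 1, hlt⟩ (by simp only; omega)
        rw [tailSum] at this
        rw [hI, this, h1 i ⟨i + 1, hlt⟩ rfl, add_comm]
      · have hI : Finset.Ioi i = ∅ := by
          ext j; simp only [Finset.mem_Ioi, Fin.lt_def, Finset.notMem_empty, iff_false]; omega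
        rw [hI, Finset.sum_empty, add_zero, h2 i (by omega)]
  exact funext fun i => key _ i rfl

/-- The slim partition with given successive differences. -/
def slimPart {d : ℕ} (e : Fin n → Fin d) : Part n :=
  ⟨tailSum fun i => e i, tailSum_antitone _⟩

theorem IsSlim.exists_slimPart {d : ℕ} {lam : Part n} (h : IsSlim d lam) :
    ∃ e : Fin n → Fin d, slimPart e = lam := by
  obtain ⟨e, he, h1, h2⟩ := exists_eq_tailSum lam.2
  have hlt : ∀ i, e i < d := by
    intro i
    by_cases hi : (i : ℕ) + 1 < n
    · have := h.1 i ⟨i + 1, hi⟩ rfl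
      have := h1 i ⟨i + 1, hi⟩ rfl
      omega
    · have := h.2 i (by omega)
      have := h2 i (by omega)
      omega
  exact ⟨fun i => ⟨e i, hlt i⟩, Subtype.ext he⟩

/-- Divide each successive difference by `d`: the quotients build `ν`, the remainders the slim part.
-/
theorem exists_slimPart_add_smul {d : ℕ} (hd : 0 < d) {a : Fin n → ℕ} (ha : Antitone a) :
    ∃ (e : Fin n → Fin d) (ν : Part n), ∀ i, a i = d * ν.1 i + (slimPart e).1 i := by
  obtain ⟨e, rfl, -⟩ := exists_eq_tailSum ha
  refine ⟨fun i => ⟨e i % d, Nat.mod_lt _ hd⟩,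
    ⟨tailSum fun i => e i / d, tailSum_antitone _⟩, fun i => ?_⟩
  simp only [slimPart, tailSum, Finset.mul_sum, ← Finset.sum_add_distrib, Nat.div_add_mod]

/-! ### Symmetric polynomials on a Frobenius fibre. -/

theorem eval_comp_perm {p : MvPolynomial (Fin n) ℂ} (hp : p.IsSymmetric)
    (w : Equiv.Perm (Fin n)) (x : Fin n → ℂ) : eval (x ∘ w) p = eval x p := by
  rw [← eval_rename, hp w]

theorem isSymmetric_expand {p : MvPolynomial (Fin n) ℂ} (hp : p.IsSymmetric) (d : ℕ) :
    (expand d p).IsSymmetric := fun e => by rw [rename_expand, hp e]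

theorem eval_expand_of_pow_eq {d : ℕ} {x y : Fin n → ℂ} (h : ∀ j, x j ^ d = y j)
    (p : MvPolynomial (Fin n) ℂ) : eval x (expand d p) = eval y p := by
  rw [eval_expand]
  congr 2
  exact funext h

/-- On a fibre of the Frobenius map, every symmetric polynomial is a linear combination of
polynomials with slim highest partitions. -/
theorem eval_mem_span_of_isSymmetric {d : ℕ} (hd : 0 < d)
    {G : (Fin n → Fin d) → MvPolynomial (Fin n) ℂ}
    (hG : ∀ e, HasHighestPartition (G e) (slimPart e)) {ι : Type*} {P : ι → Fin n → ℂ}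
    {y : Fin n → ℂ} (hP : ∀ a j, P a j ^ d = y j) (p : MvPolynomial (Fin n) ℂ)
    (hp : p.IsSymmetric) :
    (fun a => eval (P a) p) ∈ Submodule.span ℂ (Set.range fun e a => eval (P a) (G e)) := by
  obtain ⟨m, hm⟩ : ∃ m, lex.toSyn (lex.degree p) = m := ⟨_, rfl⟩
  induction m using WellFoundedLT.induction generalizing p with
  | ind m ih =>
    rcases eq_or_ne p 0 with rfl | h0
    · simp only [map_zero]
      exact Submodule.zero_mem _
    obtain ⟨e, ν, hν⟩ := exists_slimPart_add_smul hd (antitone_degree hp)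
    -- `Q` is symmetric with the leading exponent of `p`, so subtracting a multiple of it lowers the
    -- degree.
    set Q := expand d (monomialSymm ν) * G e with hQ
    have hm0 : monomialSymm ν ≠ 0 := fun h =>
      (HasHighestPartition.monomialSymm ν).coeff_ne_zero (by simp [h])
    have hG0 : G e ≠ 0 := fun h => (hG e).coeff_ne_zero (by simp [h])
    have hE0 : expand d (monomialSymm ν) ≠ 0 := (expand_ne_zero hd).2 hm0
    have hQ0 : Q ≠ 0 := mul_ne_zero hE0 hG0
    have hQdeg : lex.degree Q = lex.degree p := by
      rw [hQ, degree_mul hE0 hG0, degree_expand hd.ne' hm0,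
        (HasHighestPartition.monomialSymm ν).degree_eq, (hG e).degree_eq]
      ext i
      simp [hν i]
    set α := lex.leadingCoeff p / lex.leadingCoeff Q with hα
    have hQl : lex.leadingCoeff Q ≠ 0 := lex.leadingCoeff_ne_zero_iff.2 hQ0
    have hQsymm : Q.IsSymmetric :=
      (isSymmetric_expand (isSymmetric_monomialSymm ν) d).mul (hG e).isSymmetric
    have hsymm : (p - α • Q).IsSymmetric := hp.sub (hQsymm.smul α)
    have hrest : (fun a => eval (P a) (p - α • Q)) ∈
        Submodule.span ℂ (Set.range fun e a => eval (P a) (G e)) := by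
      rcases eq_or_ne (p - α • Q) 0 with hz | hz
      · simp only [hz, map_zero]
        exact Submodule.zero_mem _
      refine ih _ ?_ _ hsymm rfl
      rw [← hm]
      have hmem := lex.coeff_degree_ne_zero_iff.2 hz
      refine lt_of_le_of_ne ?_ fun heq => hmem ?_
      · by_contra! hlt
        refine hmem ?_
        rw [coeff_sub, coeff_smul, lex.coeff_eq_zero_of_lt hlt,
          lex.coeff_eq_zero_of_lt (hQdeg ▸ hlt)]
        simp
      · rw [lex.toSyn.injective heq, coeff_sub, coeff_smul]
        nth_rewrite 2 [← hQdeg]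
        change lex.leadingCoeff p - α • lex.leadingCoeff Q = 0
        rw [hα, smul_eq_mul, div_mul_cancel₀ _ hQl, sub_self]
    -- The Frobenius factor of `Q` is constant on the fibre, so `Q` contributes only a multiple of
    -- `G e`.
    have hsum : (fun a => eval (P a) p) = (fun a => eval (P a) (p - α • Q)) +
        (α * eval y (monomialSymm ν)) • fun a => eval (P a) (G e) := by
      ext a
      simp only [hQ, map_sub, smul_eval, map_mul, Pi.add_apply, Pi.smul_apply, smul_eq_mul,
        eval_expand_of_pow_eq (hP a)]
      ring
    rw [hsum]
    exact Submodule.add_mem _ hrest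
      (Submodule.smul_mem _ _ (Submodule.subset_span ⟨e, rfl⟩))

/-- Symmetric polynomials separate the orbits of points with distinct coordinates. -/
theorem exists_isSymmetric_eval_eq_ite {x : Fin n → ℂ} (hx : Function.Injective x)
    (B : Finset ℂ) (hxB : ∀ j, x j ∈ B) :
    ∃ p : MvPolynomial (Fin n) ℂ, p.IsSymmetric ∧ eval x p = 1 ∧
      ∀ z : Fin n → ℂ, (∀ j, z j ∈ B) → (∀ w : Equiv.Perm (Fin n), z ∘ w ≠ x) →
        eval z p = 0 := by
  classical
  -- On the grid `B ^ n`, `u` vanishes exactly off `x`; `p` is its normalised symmetrisation.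
  let u : MvPolynomial (Fin n) ℂ := ∏ j, ∏ b ∈ B.erase (x j), (X j - C b)
  have hu0 : ∀ z : Fin n → ℂ, (∀ j, z j ∈ B) → z ≠ x → eval z u = 0 := by
    intro z hz hne
    obtain ⟨j, hj⟩ := Function.ne_iff.1 hne
    simp only [u, map_prod, map_sub, eval_X, eval_C]
    exact Finset.prod_eq_zero (Finset.mem_univ j)
      (Finset.prod_eq_zero (Finset.mem_erase.2 ⟨hj, hz j⟩) (sub_self _))
  have hux : eval x u ≠ 0 := by
    simp only [u, map_prod, map_sub, eval_X, eval_C]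
    refine Finset.prod_ne_zero_iff.2 fun j _ => Finset.prod_ne_zero_iff.2 fun b hb => ?_
    exact sub_ne_zero.2 (Finset.ne_of_mem_erase hb).symm
  let p : MvPolynomial (Fin n) ℂ :=
    (eval x u)⁻¹ • ∑ w : Equiv.Perm (Fin n), rename w u
  have hp : ∀ z, eval z p = (eval x u)⁻¹ * ∑ w : Equiv.Perm (Fin n), eval (z ∘ w) u := by
    intro z
    simp [p, smul_eval, eval_rename]
  refine ⟨p, ?_, ?_, ?_⟩
  · refine IsSymmetric.smul _ fun e => ?_
    simp only [map_sum, rename_rename]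
    exact Fintype.sum_equiv (Equiv.mulLeft e) _ _ fun w => rfl
  · rw [hp, Finset.sum_eq_single 1]
    · exact inv_mul_cancel₀ hux
    · intro w _ hw
      refine hu0 _ (fun j => hxB _) fun h => hw (Equiv.ext fun j => hx (congrFun h j))
    · simp
  · intro z hz hne
    rw [hp, Finset.sum_eq_zero fun (w : Equiv.Perm (Fin n)) _ => hu0 (z ∘ w) (fun j => hz _) (hne w), mul_zero]

/-- Polynomials with distinct slim highest partitions are linearly independent on the fibre of
the Frobenius map over a point with distinct nonzero coordinates. -/
theorem eq_zero_of_sum_eval_eq_zero {d : ℕ} (hd : 0 < d) {q : ℂ} (hq : IsPrimitiveRoot q d)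
    {s : ℕ} {lam : Fin s → Part n} (hslim : ∀ i, IsSlim d (lam i))
    (hdist : Function.Injective lam) {g : Fin s → MvPolynomial (Fin n) ℂ}
    (hg : ∀ i, HasHighestPartition (g i) (lam i)) {y : Fin n → ℂ} (hy : Function.Injective y)
    (hy0 : ∀ j, y j ≠ 0) {c : Fin s → ℂ}
    (hc : ∀ x : Fin n → ℂ, (∀ j, x j ^ d = y j) → ∑ i, c i * eval x (g i) = 0) (i : Fin s) :
    c i = 0 := by
  classical
  choose ρ hρ using fun j => IsAlgClosed.exists_pow_nat_eq (y j) hd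
  have hρ0 : ∀ j, ρ j ≠ 0 := fun j h => hy0 j (by rw [← hρ, h, zero_pow hd.ne'])
  let P : (Fin n → Fin d) → Fin n → ℂ := fun a j => ρ j * q ^ (a j : ℕ)
  have hP : ∀ a j, P a j ^ d = y j := fun a j => by
    rw [mul_pow, hρ, pow_right_comm, hq.pow_eq_one, one_pow, mul_one]
  have hPinj : Function.Injective P := fun a b hab => funext fun j => Fin.ext <|
    hq.pow_inj (a j).2 (b j).2 (mul_left_cancel₀ (hρ0 j) (congrFun hab j))
  choose E hE using fun i => (hslim i).exists_slimPart
  have hEinj : Function.Injective E := fun a b hab => hdist (by rw [← hE a, ← hE b, hab])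
  -- Complete the `g i` to a family indexed by all slim partitions, so that cardinality can be
  -- compared with dimension.
  let G := Function.extend E g fun e => monomialSymm (slimPart e)
  have hG : ∀ e, HasHighestPartition (G e) (slimPart e) := by
    intro e
    by_cases he : ∃ i, E i = e
    · obtain ⟨i, rfl⟩ := he
      simp only [G, hEinj.extend_apply, hE]
      exact hg i
    · simp only [G, Function.extend_apply' _ _ _ he]
      exact .monomialSymm _
  let V : (Fin n → Fin d) → (Fin n → Fin d) → ℂ := fun e a => eval (P a) (G e)
  have hspan : ⊤ ≤ Submodule.span ℂ (Set.range V) := by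
    intro v _
    rw [pi_eq_sum_univ' v]
    refine Submodule.sum_mem _ fun a _ => Submodule.smul_mem _ _ ?_
    have hPa : Function.Injective (P a) := fun j l hjl => hy (by rw [← hP a, ← hP a, hjl])
    obtain ⟨p, hp, hp1, hp0⟩ := exists_isSymmetric_eval_eq_ite hPa
      (Finset.univ.image fun z : (Fin n → Fin d) × Fin n => P z.1 z.2)
      (fun j => Finset.mem_image.2 ⟨(a, j), Finset.mem_univ _, rfl⟩)
    convert eval_mem_span_of_isSymmetric hd hG hP p hp using 1
    ext b
    by_cases hab : a = b
    · subst hab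
      simp [hp1]
    · rw [hp0 (P b) (fun j => Finset.mem_image.2 ⟨(b, j), Finset.mem_univ _, rfl⟩)]
      · simp [hab]
      · intro w hw
        -- Taking `d`-th powers, `w` must fix `y`, whose coordinates are distinct.
        have hw1 : ∀ j, w j = j := fun j => hy (by rw [← hP b, ← hP a, ← hw]; rfl)
        refine hab (hPinj ?_)
        rw [← hw]
        ext j
        simp [hw1]
  have hli : LinearIndependent ℂ V :=
    linearIndependent_of_top_le_span_of_card_eq_finrank hspan (by simp)
  have hli' := hli.comp E hEinj
  rw [Fintype.linearIndependent_iff] at hli'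
  refine hli' c ?_ i
  ext a
  have := hc (P a) (hP a)
  simpa [V, G, hEinj.extend_apply] using this

/-! ### Density of generic points. -/

/-- A polynomial that vanishes wherever a nonzero polynomial does not vanish is zero. -/
theorem eq_zero_of_eval_eq_zero_of_ne {σ : Type*} {p D : MvPolynomial σ ℂ} (hD : D ≠ 0)
    (h : ∀ z, eval z D ≠ 0 → eval z p = 0) : p = 0 := by
  have : p * D = 0 := MvPolynomial.funext fun z => by
    rw [map_mul, map_zero, mul_eq_zero, or_iff_not_imp_right]
    exact h z
  exact (mul_eq_zero.1 this).resolve_right hD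

/-- If the image of a polynomial map contains a point with distinct nonzero coordinates, a
polynomial that vanishes at all such points of the image vanishes on the image. -/
theorem eval_eq_zero_of_generic (φ : Fin n → MvPolynomial (Fin n) ℂ)
    (hφ : ∃ z : Fin n → ℂ, (Function.Injective fun j => eval z (φ j)) ∧
      ∀ j, eval z (φ j) ≠ 0) {p : MvPolynomial (Fin n) ℂ}
    (hp : ∀ z : Fin n → ℂ, (Function.Injective fun j => eval z (φ j)) →
      (∀ j, eval z (φ j) ≠ 0) → eval (fun j => eval z (φ j)) p = 0) (z : Fin n → ℂ) :
    eval (fun j => eval z (φ j)) p = 0 := by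
  classical
  let D : MvPolynomial (Fin n) ℂ :=
    (∏ j, φ j) * ∏ ij ∈ Finset.univ.filter fun ij : Fin n × Fin n => ij.1 ≠ ij.2,
      (φ ij.1 - φ ij.2)
  have hD : ∀ z, eval z D ≠ 0 ↔
      (Function.Injective fun j => eval z (φ j)) ∧ ∀ j, eval z (φ j) ≠ 0 := by
    intro z
    simp only [D, map_mul, map_prod, mul_ne_zero_iff, Finset.prod_ne_zero_iff, map_sub,
      Finset.mem_univ, true_implies, Finset.mem_filter, true_and, sub_ne_zero, Prod.forall]
    rw [and_comm]
    refine and_congr_left fun _ => ⟨fun h a b hab => ?_, fun h a b hab => h.ne hab⟩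
    by_contra hne
    exact h a b hne hab
  have heval : ∀ z, eval z (aeval φ p) = eval (fun j => eval z (φ j)) p := by
    intro z
    rw [← coe_aeval_eq_eval, ← coe_aeval_eq_eval]
    simp only [RingHom.coe_coe, ← AlgHom.comp_apply, comp_aeval]
  have : aeval φ p = 0 := by
    refine eq_zero_of_eval_eq_zero_of_ne (D := D) ?_ fun z hz => ?_
    · rintro h
      obtain ⟨z, hz⟩ := hφ
      exact (hD z).2 hz (by rw [h, map_zero])
    · rw [heval]
      exact hp z ((hD z).1 hz).1 ((hD z).1 hz).2
  rw [← heval, this, map_zero]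

/-! ### The wheel condition through the Frobenius map. -/

/-- The wheel condition, with the point given up to roots of unity of order `r - 1` on the
`k + 1` coordinates of a minimal wheel. -/
theorem mem_F_iff {k r : ℕ} (hr : 2 ≤ r) (hkr : Nat.Coprime (k + 1) (r - 1)) {t q : ℂ}
    (ht : IsPrimitiveRoot t (k + 1)) (hq : IsPrimitiveRoot q (r - 1))
    {f : MvPolynomial (Fin n) ℂ} (hf : f.IsSymmetric) :
    f ∈ F n r q t ↔ ∀ (ι : Fin (k + 1) ↪ Fin n) (x : Fin n → ℂ) (c : ℂ),
      (∀ i, x (ι i) ^ (r - 1) = (t ^ (r - 1)) ^ (i : ℕ) * c) → eval x f = 0 := by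
  have hd : 0 < r - 1 := by omega
  have ht0 : t ≠ 0 := ht.ne_zero (Nat.succ_ne_zero k)
  constructor
  · rintro ⟨-, hf'⟩ ι x c hx
    have hl : k + 1 ≤ n := by simpa using Fintype.card_le_of_embedding ι
    obtain ⟨w, hw⟩ := Equiv.Perm.exists_extending_pair (Fin.castLE hl) ι
      (Fin.castLE_injective hl) ι.injective
    have hrot : ∀ i : Fin (k + 1),
        x (ι (finRotate _ i)) ^ (r - 1) = (t * x (ι i)) ^ (r - 1) := by
      intro i
      rw [hx, mul_pow, hx]
      rcases Fin.eq_castSucc_or_eq_last i with ⟨i, rfl⟩ | rfl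
      · rw [finRotate_of_lt (by simp)]
        simp [pow_succ]
        ring
      · rw [finRotate_last, ← mul_assoc, ← pow_succ', Fin.val_last, Fin.val_zero, pow_zero,
          pow_right_comm, ht.pow_eq_one, one_pow]
    -- At a zero coordinate the exponent is arbitrary; choosing `0` gives resonance when `c = 0`,
    -- since then the product is `t ^ (k + 1)`.
    have hroot : ∀ i : Fin (k + 1), ∃ a < r - 1,
        x (ι (finRotate _ i)) = t * q ^ a * x (ι i) ∧ (x (ι i) = 0 → a = 0) := by
      intro i
      by_cases h0 : x (ι i) = 0
      · refine ⟨0, hd, ?_, fun _ => rfl⟩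
        have := hrot i
        rw [h0, mul_zero, zero_pow hd.ne'] at this
        rw [h0, mul_zero, pow_eq_zero_iff hd.ne' |>.1 this]
      · have hne : t * x (ι i) ≠ 0 := mul_ne_zero ht0 h0
        have h1 : (x (ι (finRotate _ i)) / (t * x (ι i))) ^ (r - 1) = 1 := by
          rw [div_pow, hrot, div_self (pow_ne_zero _ hne)]
        have : NeZero (r - 1) := ⟨hd.ne'⟩
        obtain ⟨a, ha, hqa⟩ := hq.eq_pow_of_pow_eq_one h1
        refine ⟨a, ha, ?_, fun h => absurd h h0⟩
        rw [hqa]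
        field_simp
    choose a ha hxa ha0 using hroot
    rw [← eval_comp_perm hf w x]
    refine hf' (k + 1) k.succ_pos hl (fun i => t * q ^ a i) (fun i => ⟨a i, ha i, rfl⟩) ?_ _ ?_
    · have hprod : ∏ i, x (ι i) = (∏ i, t * q ^ a i) * ∏ i, x (ι i) := by
        rw [← Finset.prod_mul_distrib, ← Equiv.prod_comp (finRotate (k + 1))]
        exact Finset.prod_congr rfl fun i _ => hxa i
      by_cases h0 : c = 0
      · have hz : ∀ i, a i = 0 := fun i => ha0 i <|
          (pow_eq_zero_iff hd.ne').1 (by rw [hx, h0, mul_zero])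
        simp [hz, ht.pow_eq_one]
      · refine (mul_eq_right₀ (Finset.prod_ne_zero_iff.2 fun i _ h => h0 ?_)).1 hprod.symm
        have := hx i
        rw [h, zero_pow hd.ne'] at this
        exact (mul_eq_zero.1 this.symm).resolve_left (pow_ne_zero _ (pow_ne_zero _ ht0))
    · intro i
      simp only [Function.comp_apply, hw]
      exact hxa i
  · intro H
    refine ⟨hf, fun l h0 hl τ hτ hp x hx => ?_⟩
    choose a ha hτa using hτ
    have hpow : ∀ i, τ i ^ (r - 1) = t ^ (r - 1) := fun i => by
      rw [hτa, mul_pow, pow_right_comm, hq.pow_eq_one, one_pow, mul_one]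
    -- The `d`-th power of the resonance condition reads `t ^ (d * l) = 1`. Hence every wheel
    -- contains `k + 1` consecutive coordinates as in the criterion.
    have hdvd : k + 1 ∣ l := by
      have h1 : (t ^ (r - 1)) ^ l = 1 := by
        rw [← one_pow (M := ℂ) (r - 1), ← hp, ← Finset.prod_pow]
        simp [hpow]
      rw [← pow_mul] at h1
      exact hkr.dvd_of_dvd_mul_left (ht.dvd_of_pow_eq_one _ h1)
    have hkl : k + 1 ≤ l := Nat.le_of_dvd h0 hdvd
    obtain ⟨l, rfl⟩ : ∃ l', l = l' + 1 := ⟨l - 1, by omega⟩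
    have key : ∀ (i : ℕ) (hi : i < l + 1), x (Fin.castLE hl ⟨i, hi⟩) ^ (r - 1) =
        (t ^ (r - 1)) ^ i * x (Fin.castLE hl 0) ^ (r - 1) := by
      intro i
      induction i with
      | zero => intro hi; simp
      | succ i ih =>
        intro hi
        have := hx ⟨i, by omega⟩
        rw [finRotate_of_lt (by simpa using hi)] at this
        rw [this, mul_pow, ih (by omega), hpow]
        ring
    exact H (Fin.castLEEmb (hkl.trans hl)) x _ fun i => key i (by omega)

theorem mem_F_two_iff {k : ℕ} {t : ℂ} (ht : IsPrimitiveRoot t (k + 1))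
    {f : MvPolynomial (Fin n) ℂ} (hf : f.IsSymmetric) :
    f ∈ F n 2 1 t ↔ ∀ (ι : Fin (k + 1) ↪ Fin n) (y : Fin n → ℂ) (c : ℂ),
      (∀ i, y (ι i) = t ^ (i : ℕ) * c) → eval y f = 0 := by
  simpa using mem_F_iff (n := n) (r := 2) le_rfl (by simp) ht (by simp) hf

/-- Multiplication by `d` permutes the residues modulo `m`; this turns `t ^ d`-wheels into reordered
`t`-wheels. -/
theorem exists_perm_pow_eq {M : Type*} [CommMonoid M] {t : M} {m d : ℕ}
    (ht : IsPrimitiveRoot t m) (hm : m.Coprime d) :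
    ∃ w : Equiv.Perm (Fin m), ∀ i, t ^ (w i : ℕ) = (t ^ d) ^ (i : ℕ) := by
  let φ : Fin m → Fin m := fun i => ⟨d * i % m, Nat.mod_lt _ (i.pos)⟩
  have hφ : ∀ i, t ^ (φ i : ℕ) = (t ^ d) ^ (i : ℕ) := fun i => by
    simp only [φ, ht.eq_orderOf, pow_mod_orderOf, pow_mul]
  have hinj : Function.Injective φ := fun i j hij => Fin.ext <|
    (ht.pow_of_coprime d hm.symm).pow_inj i.2 j.2 (by rw [← hφ, ← hφ, hij])
  exact ⟨Equiv.ofBijective φ (Finite.injective_iff_bijective.1 hinj), hφ⟩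

theorem isSymmetric_of_mem_F {r : ℕ} {q t : ℂ} {f : MvPolynomial (Fin n) ℂ}
    (hf : f ∈ F n r q t) : f.IsSymmetric := hf.1

theorem frob_mem_F {k r : ℕ} (hr : 2 ≤ r) (hkr : Nat.Coprime (k + 1) (r - 1)) {t q : ℂ}
    (ht : IsPrimitiveRoot t (k + 1)) (hq : IsPrimitiveRoot q (r - 1))
    {f : MvPolynomial (Fin n) ℂ} (hf : f ∈ F n 2 1 t) : frob n r f ∈ F n r q t := by
  have hsymm := isSymmetric_of_mem_F hf
  rw [mem_F_two_iff ht hsymm] at hf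
  refine (mem_F_iff hr hkr ht hq (isSymmetric_expand hsymm _)).2 fun ι x c hx => ?_
  obtain ⟨w, hw⟩ := exists_perm_pow_eq ht hkr
  rw [eval_expand_of_pow_eq fun _ => rfl]
  refine hf (w.symm.toEmbedding.trans ι) _ c fun i => ?_
  have := hx (w.symm i)
  rw [← hw, w.apply_symm_apply] at this
  exact this

theorem frob_mem_R_iff {k r : ℕ} (hr : 2 ≤ r) (hkr : Nat.Coprime (k + 1) (r - 1)) {t q : ℂ}
    (ht : IsPrimitiveRoot t (k + 1)) (hq : IsPrimitiveRoot q (r - 1))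
    (f : MvPolynomial (Fin n) ℂ) : frob n r f ∈ R n r q t ↔ f ∈ F n 2 1 t := by
  constructor
  · rintro ⟨⟨f₁, hf₁, h⟩, -⟩
    rwa [← expand_injective (show 0 < r - 1 by omega) h]
  · exact fun hf => ⟨⟨f, hf, rfl⟩, frob_mem_F hr hkr ht hq hf⟩

theorem mul_mem_F {r : ℕ} {t q : ℂ} {f g : MvPolynomial (Fin n) ℂ} (hf : f ∈ F n r q t)
    (hg : g.IsSymmetric) : f * g ∈ F n r q t :=
  ⟨hf.1.mul hg, fun l h0 hl τ hτ hp x hx => by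
    rw [map_mul, hf.2 l h0 hl τ hτ hp x hx, zero_mul]⟩

/-! ### Properties of the coefficients. -/

/-- The coefficients of a symmetric combination of polynomials with distinct slim highest
partitions over the image of the Frobenius map are symmetric. -/
theorem isSymmetric_of_sum_frob_mul {r s : ℕ} (hr : 2 ≤ r) {q : ℂ}
    (hq : IsPrimitiveRoot q (r - 1)) {lam : Fin s → Part n}
    (hslim : ∀ i, IsSlim (r - 1) (lam i)) (hdist : Function.Injective lam)
    {g f : Fin s → MvPolynomial (Fin n) ℂ} (hg : ∀ i, HasHighestPartition (g i) (lam i))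
    (hsymm : (∑ i, frob n r (f i) * g i).IsSymmetric) (i : Fin s) : (f i).IsSymmetric := by
  intro e
  refine sub_eq_zero.1 (MvPolynomial.funext fun z => ?_)
  have hgen := eval_eq_zero_of_generic (X : Fin n → MvPolynomial (Fin n) ℂ)
    ⟨fun j => (j : ℂ) + 1, ?_, ?_⟩ (p := rename e (f i) - f i) ?_ z
  · simpa using hgen
  · intro a b hab
    simpa [Fin.ext_iff] using hab
  · intro j
    rw [eval_X]
    exact Nat.cast_add_one_ne_zero _
  · intro y hy hy0
    simp only [eval_X] at hy hy0 ⊢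
    refine eq_zero_of_sum_eval_eq_zero (by omega) hq hslim hdist hg hy hy0
      (c := fun i => eval y (rename e (f i) - f i)) (fun x hx => ?_) i
    -- The `g i` are symmetric, so renaming by `e` affects only the coefficients.
    have h1 := congrArg (eval x) (hsymm e)
    simp only [map_sum, map_mul, frob, rename_expand, (hg _).isSymmetric e,
      eval_expand_of_pow_eq hx] at h1
    simp only [map_sub, sub_mul, Finset.sum_sub_distrib, h1, sub_self]

/-- The coefficients of a combination in `F_n^{(k,r)}` of polynomials with distinct slim highest
partitions satisfy the wheel condition relative to `{t}`. -/
theorem mem_F_two_of_sum_frob_mul_mem_F {k r s : ℕ} (hr : 2 ≤ r)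
    (hkr : Nat.Coprime (k + 1) (r - 1)) {t q : ℂ} (ht : IsPrimitiveRoot t (k + 1))
    (hq : IsPrimitiveRoot q (r - 1)) {lam : Fin s → Part n}
    (hslim : ∀ i, IsSlim (r - 1) (lam i)) (hdist : Function.Injective lam)
    {g f : Fin s → MvPolynomial (Fin n) ℂ} (hg : ∀ i, HasHighestPartition (g i) (lam i))
    (h : ∑ i, frob n r (f i) * g i ∈ F n r q t) (i : Fin s) : f i ∈ F n 2 1 t := by
  classical
  have hsymm := isSymmetric_of_mem_F h
  rw [mem_F_iff hr hkr ht hq hsymm] at h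
  refine (mem_F_two_iff ht (isSymmetric_of_sum_frob_mul hr hq hslim hdist hg hsymm i)).2
    fun ι y c hy => ?_
  obtain ⟨w, hw⟩ := exists_perm_pow_eq ht hkr
  have ht0 : t ≠ 0 := ht.ne_zero (Nat.succ_ne_zero k)
  have htn : ‖t‖ = 1 := ht.norm'_eq_one (Nat.succ_ne_zero k)
  -- `φ` parametrises the wheel points along `ι`: `z (ι 0)` scales the wheel, the other coordinates
  -- are free.
  let φ : Fin n → MvPolynomial (Fin n) ℂ := fun j =>
    if h : ∃ i, ι i = j then C (t ^ (h.choose : ℕ)) * X (ι 0) else X j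
  have hφι : ∀ i z, eval z (φ (ι i)) = t ^ (i : ℕ) * z (ι 0) := by
    intro i z
    have hex : ∃ i', ι i' = ι i := ⟨i, rfl⟩
    have : hex.choose = i := ι.injective hex.choose_spec
    simp only [φ, dif_pos hex, this, map_mul, eval_C, eval_X]
  have hφX : ∀ j, (¬ ∃ i, ι i = j) → ∀ z, eval z (φ j) = z j := by
    intro j hj z
    simp only [φ, dif_neg hj, eval_X]
  have hφy : (fun j => eval y (φ j)) = y := by
    ext j
    by_cases hj : ∃ i, ι i = j
    · obtain ⟨i, rfl⟩ := hj
      rw [hφι, hy, hy]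
      simp
    · exact hφX j hj y
  rw [← hφy]
  refine eval_eq_zero_of_generic φ ?_ ?_ y
  -- A generic wheel point: wheel coordinates have modulus `1`, the others are distinct integers at
  -- least `2`.
  · let z : Fin n → ℂ := fun j => if j = ι 0 then 1 else (j : ℂ) + 2
    have hz0 : z (ι 0) = 1 := if_pos rfl
    have hz : ∀ j, (¬ ∃ i, ι i = j) → z j = ((j + 2 : ℕ) : ℂ) := fun j hj => by
      have : j ≠ ι 0 := fun h => hj ⟨0, h.symm⟩
      simp [z, this]
    have hne : ∀ (i : Fin (k + 1)) j, (¬ ∃ i, ι i = j) → t ^ (i : ℕ) ≠ ((j + 2 : ℕ) : ℂ) := by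
      intro i j _ heq
      have := congrArg norm heq
      rw [norm_pow, htn, one_pow, Complex.norm_natCast] at this
      have : 1 = (j : ℕ) + 2 := by exact_mod_cast this
      omega
    refine ⟨z, fun a b hab => ?_, fun j => ?_⟩
    · dsimp only at hab
      by_cases ha : ∃ i, ι i = a <;> by_cases hb : ∃ i, ι i = b
      · obtain ⟨i, rfl⟩ := ha
        obtain ⟨j, rfl⟩ := hb
        rw [hφι, hφι, hz0, mul_one, mul_one] at hab
        rw [Fin.ext (ht.pow_inj i.2 j.2 hab)]
      · obtain ⟨i, rfl⟩ := ha
        rw [hφι, hφX b hb, hz0, mul_one, hz b hb] at hab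
        exact absurd hab (hne i b hb)
      · obtain ⟨i, rfl⟩ := hb
        rw [hφι, hφX a ha, hz0, mul_one, hz a ha] at hab
        exact absurd hab.symm (hne i a ha)
      · rw [hφX a ha, hφX b hb, hz a ha, hz b hb, Nat.cast_inj] at hab
        exact Fin.ext (by omega)
    · by_cases hj : ∃ i, ι i = j
      · obtain ⟨i, rfl⟩ := hj
        rw [hφι, hz0, mul_one]
        exact pow_ne_zero _ ht0
      · rw [hφX j hj, hz j hj]
        exact Nat.cast_ne_zero.2 (by omega)
  · intro z hinj hne
    refine eq_zero_of_sum_eval_eq_zero (by omega) hq hslim hdist hg hinj hne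
      (c := fun i => eval (fun j => eval z (φ j)) (f i)) (fun x hx => ?_) i
    -- Reordering by `w` makes the `t`-wheel of `y` a `t ^ d`-wheel, so the sum vanishes on the
    -- whole fibre.
    have := h (w.toEmbedding.trans ι) x (z (ι 0)) fun i => by
      rw [← hw, hx]
      exact hφι _ z
    simpa only [map_sum, map_mul, frob, eval_expand_of_pow_eq hx] using this

end Wheel

theorem proposition4 (k r n s : ℕ) (hk : 0 < k) (hr : 2 ≤ r) (hkr : Nat.Coprime (k + 1) (r - 1))
    (t q : ℂ) (ht : IsPrimitiveRoot t (k + 1)) (hq : IsPrimitiveRoot q (r - 1))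
    (lam : Fin s → Wheel.Part n) (hslim : ∀ i, Wheel.IsSlim (r - 1) (lam i))
    (hdist : Function.Injective lam)
    (g f' : Fin s → MvPolynomial (Fin n) ℂ)
    (hg : ∀ i, Wheel.HasHighestPartition (g i) (lam i))
    (h : MvPolynomial (Fin n) ℂ) (hsymm : h.IsSymmetric)
    (hh : h = ∑ i, Wheel.frob n r (f' i) * g i) :
    (h ∈ Wheel.F n r q t ↔ ∀ i, Wheel.frob n r (f' i) ∈ Wheel.R n r q t) ∧
      ∀ i, (Wheel.frob n r (f' i) ∈ Wheel.R n r q t ↔ f' i ∈ Wheel.F n 2 1 t) := by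
  subst hh
  refine ⟨⟨fun hF i => ?_, fun hR => ?_⟩, fun i => Wheel.frob_mem_R_iff hr hkr ht hq _⟩
  · exact (Wheel.frob_mem_R_iff hr hkr ht hq _).2
      (Wheel.mem_F_two_of_sum_frob_mul_mem_F hr hkr ht hq hslim hdist hg hF i)
  · exact Submodule.sum_mem _ fun i _ => Wheel.mul_mem_F (hR i).2 (hg i).isSymmetric
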